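/- Let $G=(V,E)$ be a finite simple graph with connectivity $1$; that is, $G$ is connected and has a cut vertex (a vertex whose removal disconnects the graph). Let $d$ be the maximum number of connected components of $G-v$ over all vertices $v$ of $G$. The vertices of $G$ are regarded as items. A utility profile for two agents consists of non-negative functions $u_1,u_2$ on $V$, extended additively to subsets of $V$, with $u_1(V)=u_2(V)=1$. An allocation is an ordered partition $\mathcal M=(M_1,M_2)$ of $V$ into two (possibly empty) sets; it is connected if $M_1$ and $M_2$ each induce a connected subgraph of $G$ (the empty set counts as connected). The egalitarian welfare of $\mathcal M$ is $\min\{u_1(M_1),u_2(M_2)\}$. The egalitarian price of connectivity of $G$ for two agents is $$\textup{Egal-PoC}(G,2)=\sup_{(u_1,u_2)}\frac{\max_{\mathcal M}\min\{u_1(M_1),u_2(M_2)\}}{\max_{\mathcal M\text{ connected}}\min\{u_1(M_1),u_2(M_2)\}},$$ where the supremum is over all utility profiles and $\frac00$ is read as $1$. A block of $G$ is a maximal subgraph that is connected and stays connected after the removal of any one of its vertices (the graph without vertices counts as connected, so a bridge together with its two ends is a block). The block decomposition of $G$ is the bipartite graph with the blocks of $G$ on one side and the cut vertices of $G$ on the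 other, where a block and a cut vertex are adjacent if and only if the cut vertex belongs to the block. Then: - If $d=2$, then $\textup{Egal-PoC}(G,2)=2$ when the block decomposition of $G$ is a path, and $\textup{Egal-PoC}(G,2)=3$ otherwise. - If $d\ge 3$, then $\textup{Egal-PoC}(G,2)=d$. -/

import Mathlib

open scoped NNReal ENNReal

namespace PriceOfConnectivity

universe u

section Graph

variable {V : Type u}

/-- The sizes of the finite vertex sets whose removal leaves a disconnected graph
(the graph without vertices does not count as disconnected). -/
def separatorSizes (G : SimpleGraph V) : Set ℕ :=
  {k | ∃ S : Finset V, S.card = k ∧ ¬ (G.induce ((S : Set V)ᶜ)).Preconnected}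

/-- `G` has connectivity `k`: some `k` vertices disconnect `G` when removed, and `k` is the
smallest number with this property. -/
def HasConnectivity (G : SimpleGraph V) (k : ℕ) : Prop :=
  IsLeast (separatorSizes G) k

/-- `G` has connectivity at least `k`: no set of fewer than `k` vertices disconnects `G`.
In particular this holds for every complete graph, such as a single edge, and every `k`. -/
def ConnectivityAtLeast (G : SimpleGraph V) (k : ℕ) : Prop :=
  ∀ j ∈ separatorSizes G, k ≤ j

/-- A cut vertex: a vertex whose removal disconnects the graph. -/
def IsCutVertex (G : SimpleGraph V) (v : V) : Prop :=
  ¬ (G.induce ({v}ᶜ : Set V)).Preconnected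

/-- A block: a maximal subgraph with connectivity at least `2`. -/
def IsBlock (G : SimpleGraph V) (B : G.Subgraph) : Prop :=
  Maximal (fun H : G.Subgraph => ConnectivityAtLeast H.coe 2) B

/-- The block decomposition (block-cut-vertex tree): the bipartite graph between the blocks and
the cut vertices, in which a block is joined to the cut vertices that belong to it. -/
def blockDecomposition (G : SimpleGraph V) :
    SimpleGraph ({B : G.Subgraph // IsBlock G B} ⊕ {v : V // IsCutVertex G v}) where
  Adj x y := match x, y with
    | .inl B, .inr v => v.1 ∈ B.1.verts
    | .inr v, .inl B => v.1 ∈ B.1.verts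
    | _, _ => False
  symm := ⟨by
    rintro (B | v) (B' | v') h
    · exact h
    · exact h
    · exact h
    · exact h⟩
  loopless := ⟨by
    rintro (B | v) h
    · exact h
    · exact h⟩

/-- The graph is a path. -/
def IsPathGraph {W : Type u} (H : SimpleGraph W) : Prop :=
  ∃ k : ℕ, Nonempty (H ≃g SimpleGraph.pathGraph k)

/-- The maximum number of connected components left when one vertex is removed. -/
noncomputable def maxComponents [Fintype V] (G : SimpleGraph V) : ℕ :=
  Finset.univ.sup fun v : V => Nat.card (G.induce ({v}ᶜ : Set V)).ConnectedComponent

end Graph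

section Welfare

variable {V : Type u} [Fintype V] {n : ℕ}

/-- Utility profiles of `n` agents: agent `i` has utility `util i g ≥ 0` for the item `g`, and
total utility `1`. Utilities of bundles are obtained by summation. -/
structure UtilityProfile (V : Type u) [Fintype V] (n : ℕ) where
  util : Fin n → V → ℝ≥0
  normalized : ∀ i, ∑ g, util i g = 1

/-- An allocation is given by the agent who receives each item; the bundle of agent `i` is
`{g | a g = i}`. Thus bundles are disjoint, cover all items, and may be empty. -/
abbrev Allocation (V : Type u) (n : ℕ) := V → Fin n

/-- Every bundle induces a connected subgraph (the empty bundle is connected). -/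
def IsConnectedAllocation (G : SimpleGraph V) (a : Allocation V n) : Prop :=
  ∀ i, (G.induce {g | a g = i}).Preconnected

/-- The egalitarian welfare: the minimum over the agents of the utility of their own bundle. -/
noncomputable def egalWelfare (U : UtilityProfile V n) (a : Allocation V n) : ℝ≥0∞ :=
  ⨅ i, ((∑ g with a g = i, U.util i g : ℝ≥0) : ℝ≥0∞)

/-- The optimal egalitarian welfare over all allocations. -/
noncomputable def optEgal (U : UtilityProfile V n) : ℝ≥0∞ :=
  ⨆ a : Allocation V n, egalWelfare U a

/-- The optimal egalitarian welfare over the connected allocations. -/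
noncomputable def optEgalConnected (G : SimpleGraph V) (U : UtilityProfile V n) : ℝ≥0∞ :=
  ⨆ a : {a : Allocation V n // IsConnectedAllocation G a}, egalWelfare U a.1

/-- The egalitarian welfare ratio of an instance, where `0 / 0` is read as `1`
(and `x / 0 = ∞` for `x ≠ 0`). -/
noncomputable def egalRatio (G : SimpleGraph V) (U : UtilityProfile V n) : ℝ≥0∞ :=
  if optEgal U = 0 ∧ optEgalConnected G U = 0 then 1
  else optEgal U / optEgalConnected G U

/-- The egalitarian price of connectivity of `G` for `n` agents. -/
noncomputable def egalPoC (G : SimpleGraph V) (n : ℕ) : ℝ≥0∞ :=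
  ⨆ U : UtilityProfile V n, egalRatio G U

end Welfare

end PriceOfConnectivity

/-! Upper bounds: fix any allocation of welfare `w` and let each agent value only the items of the
own bundle. The two valuations then have disjoint supports and totals at least `w`, so the price is
at most `D` once some cut into two connected sides gives both agents `w / D` (`egalPoC_le`). A
failure is a `NoGoodCut` with `t = w / D`. In it every cut into connected sides has a light side,
that is, one worth less than `t` to both agents (`NoGoodCut.light_or`). A maximal light side `P`
with connected complement makes larger sides have light complements. If `D ≥ 3` bounds the number of
components at every vertex, a few light sets then cover too much of the graph
(`NoGoodCut.false_of_three_le`). If every vertex leaves at most two components and `D = 2`, the only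
escape is a fork: three cut vertices, each cutting off a private vertex from the other two
(`NoGoodCut.hasFork`).

Lower bounds: one agent wants a cut vertex `v` and the other one item in each component of `G - v`
(`numComponents_le_egalPoC`); or one wants the three cut vertices of a fork and the other the three
private vertices (`HasFork.three_le_egalPoC`).

When every vertex leaves at most two components and a cut vertex exists, the block decomposition is
a path exactly when there is no fork (`not_hasFork_of_isPathGraph`, `isPathGraph_of_not_hasFork`).
Blocks are handled as maximal sets of vertices that no single vertex separates. -/

open scoped NNReal ENNReal

namespace PriceOfConnectivity

universe u

/-! ### Connectivity inside vertex sets, without passing to induced subgraphs -/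

section Joins

variable {V : Type u} {G : SimpleGraph V} {S T : Set V} {x y z a v : V}

/-- `x` and `y` are joined by a walk of `G` that stays inside `S`. -/
def Joins (G : SimpleGraph V) (S : Set V) (x y : V) : Prop :=
  ∃ p : G.Walk x y, ∀ z ∈ p.support, z ∈ S

/-- Any two vertices of `S` are joined inside `S`. -/
def Conn (G : SimpleGraph V) (S : Set V) : Prop :=
  ∀ x ∈ S, ∀ y ∈ S, Joins G S x y

/-- The vertices that are joined to `x` inside `S`. -/
def comp (G : SimpleGraph V) (S : Set V) (x : V) : Set V :=
  {y | Joins G S x y}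

theorem Joins.refl (h : x ∈ S) : Joins G S x x :=
  ⟨.nil, by simpa using h⟩

theorem Joins.symm (h : Joins G S x y) : Joins G S y x := by
  obtain ⟨p, hp⟩ := h
  exact ⟨p.reverse, by simpa using hp⟩

theorem Joins.trans (h : Joins G S x y) (h' : Joins G S y z) : Joins G S x z := by
  obtain ⟨p, hp⟩ := h
  obtain ⟨q, hq⟩ := h'
  refine ⟨p.append q, fun w hw => ?_⟩
  rw [SimpleGraph.Walk.mem_support_append_iff] at hw
  exact hw.elim (hp w) (hq w)

theorem Joins.mono (hST : S ⊆ T) (h : Joins G S x y) : Joins G T x y := by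
  obtain ⟨p, hp⟩ := h
  exact ⟨p, fun z hz => hST (hp z hz)⟩

theorem Joins.left_mem (h : Joins G S x y) : x ∈ S := by
  obtain ⟨p, hp⟩ := h
  exact hp x p.start_mem_support

theorem Joins.right_mem (h : Joins G S x y) : y ∈ S :=
  h.symm.left_mem

theorem Joins.of_adj (h : G.Adj x y) (hx : x ∈ S) (hy : y ∈ S) : Joins G S x y :=
  ⟨h.toWalk, by simp [hx, hy]⟩

/-- Induction along the walk, from its start. -/
theorem Joins.induction {P : V → Prop} (h : Joins G S x y) (base : P y)
    (step : ∀ u w, u ∈ S → w ∈ S → G.Adj u w → P w → P u) : P x := by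
  obtain ⟨p, hp⟩ := h
  induction p with
  | nil => exact base
  | cons hadj q ih =>
    have hq : ∀ z ∈ q.support, z ∈ S := fun z hz => hp z (by simp [hz])
    exact step _ _ (hp _ (by simp)) (hq _ q.start_mem_support) hadj (ih base hq)

/-- A set that is closed under adjacency inside `S` contains everything joined to its members. -/
theorem Joins.mem_of_closed {C : Set V} (h : Joins G S x y) (hx : x ∈ C)
    (hC : ∀ u w, u ∈ C → G.Adj u w → w ∈ S → w ∈ C) : y ∈ C :=
  h.symm.induction hx fun u w hu _ hadj hw => hC w u hw hadj.symm hu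

theorem mem_comp_self (h : x ∈ S) : x ∈ comp G S x := Joins.refl h

theorem comp_subset : comp G S x ⊆ S := fun _ hy => Joins.right_mem hy

theorem comp_closed (hy : y ∈ comp G S x) (h : G.Adj y z) (hz : z ∈ S) : z ∈ comp G S x :=
  Joins.trans hy (.of_adj h (comp_subset hy) hz)

theorem Joins.comp (h : Joins G S x y) : Joins G (comp G S x) x y := by
  have := h.symm.induction (P := fun w => Joins G S x w ∧ Joins G (PriceOfConnectivity.comp G S x) x w)
    ⟨.refl h.left_mem, .refl (mem_comp_self h.left_mem)⟩
    fun u w hu hw hadj ⟨h1, h2⟩ =>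
      have h3 := h1.trans (.of_adj hadj.symm hw hu)
      ⟨h3, h2.trans (.of_adj hadj.symm h1 h3)⟩
  exact this.2

theorem conn_comp : Conn G (comp G S x) :=
  fun _ hy _ hz => (Joins.comp hy).symm.trans (Joins.comp hz)

theorem Conn.of_center (h : ∀ x ∈ S, Joins G S x v) : Conn G S :=
  fun x hx y hy => (h x hx).trans (h y hy).symm

theorem conn_empty : Conn G ∅ := fun _ h => h.elim

theorem conn_singleton : Conn G {v} := by
  rintro x rfl y rfl
  exact .refl rfl

theorem Conn.subset_comp (h : Conn G S) (hST : S ⊆ T) (hx : x ∈ S) : S ⊆ comp G T x :=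
  fun y hy => (h x hx y hy).mono hST

theorem Conn.union (hS : Conn G S) (hT : Conn G T) (hx : x ∈ S) (hy : y ∈ T)
    (h : G.Adj x y) : Conn G (S ∪ T) := by
  refine Conn.of_center (v := x) ?_
  rintro z (hz | hz)
  · exact (hS z hz x hx).mono Set.subset_union_left
  · exact ((hT z hz y hy).mono Set.subset_union_right).trans (.of_adj h.symm (.inr hy) (.inl hx))

theorem Conn.insert (hS : Conn G S) (h : S.Nonempty → ∃ x ∈ S, G.Adj x v) :
    Conn G (S ∪ {v}) := by
  rcases S.eq_empty_or_nonempty with rfl | hne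
  · simpa using conn_singleton
  · obtain ⟨x, hx, hadj⟩ := h hne
    exact hS.union conn_singleton hx rfl hadj

/-- Removing from a connected set a set that is closed under adjacency away from `v` leaves a
connected set. -/
theorem Conn.diff_closed {C : Set V} (hS : Conn G S) (hv : v ∈ S) (hvC : v ∉ C)
    (hC : ∀ u w, u ∈ C → G.Adj u w → w ∈ S → w ≠ v → w ∈ C) : Conn G (S \ C) := by
  refine Conn.of_center (v := v) ?_
  rintro z ⟨hz, hzC⟩
  refine (hS z hz v hv).induction (P := fun w => w ∉ C → Joins G (S \ C) w v)
    (fun _ => Joins.refl ⟨hv, hvC⟩) ?_ hzC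
  intro u w hu hw hadj ih huC
  by_cases huv : u = v
  · subst huv; exact Joins.refl ⟨hv, hvC⟩
  have hwC : w ∉ C := fun h => huC (hC w u h hadj.symm hu huv)
  exact (Joins.of_adj (S := S \ C) hadj ⟨hu, huC⟩ ⟨hw, hwC⟩).trans (ih hwC)

/-- In a connected set each component left by the removal of `v` is attached to `v`. -/
theorem Conn.joins_center (hS : Conn G S) (hv : v ∈ S) (hx : x ∈ S) (hxv : x ≠ v) :
    Joins G (comp G (S \ {v}) x ∪ {v}) x v := by
  refine (hS x hx v hv).induction
    (P := fun w => w ∈ comp G (S \ {v}) x → Joins G (comp G (S \ {v}) x ∪ {v}) w v)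
    (fun _ => Joins.refl (.inr rfl)) ?_ (mem_comp_self ⟨hx, hxv⟩)
  intro u w hu hw hadj ih huC
  by_cases hwv : w = v
  · subst hwv; exact .of_adj hadj (.inl huC) (.inr rfl)
  · have hwC := comp_closed huC hadj ⟨hw, hwv⟩
    exact (Joins.of_adj hadj (.inl huC) (.inl hwC)).trans (ih hwC)

theorem Joins.of_hom {W : Type*} {H : SimpleGraph W} (f : H →g G) {a b : W} (p : H.Walk a b)
    (hp : ∀ w ∈ p.support, f w ∈ S) : Joins G S (f a) (f b) := by
  refine ⟨p.map f, fun z hz => ?_⟩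
  rw [SimpleGraph.Walk.support_map, List.mem_map] at hz
  obtain ⟨w, hw, rfl⟩ := hz
  exact hp w hw

theorem conn_iff : Conn G S ↔ (G.induce S).Preconnected := by
  constructor
  · intro h x y
    obtain ⟨p, hp⟩ := h x x.2 y y.2
    exact ⟨p.induce S hp⟩
  · intro h x hx y hy
    obtain ⟨p⟩ := h ⟨x, hx⟩ ⟨y, hy⟩
    exact Joins.of_hom (SimpleGraph.Embedding.induce S).toHom p fun w _ => w.2

theorem reachable_iff (x y : S) : (G.induce S).Reachable x y ↔ Joins G S x y := by
  constructor
  · rintro ⟨p⟩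
    exact Joins.of_hom (SimpleGraph.Embedding.induce S).toHom p fun w _ => w.2
  · rintro ⟨p, hp⟩
    exact ⟨p.induce S hp⟩

theorem isCutVertex_iff : IsCutVertex G v ↔ ¬ Conn G {v}ᶜ := by
  rw [IsCutVertex, conn_iff]

/-- A connected set together with a nonempty disjoint part of the graph has a vertex outside
which is adjacent to it. -/
theorem exists_adj_of_conn_univ (hG : Conn G Set.univ) (hS : S.Nonempty) (hS' : Sᶜ.Nonempty) :
    ∃ x ∈ S, ∃ y ∈ Sᶜ, G.Adj x y := by
  obtain ⟨x, hx⟩ := hS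
  obtain ⟨y, hy⟩ := hS'
  by_contra! hcon
  exact hy ((hG x trivial y trivial).mem_of_closed hx
    fun u w hu hadj _ => by_contra fun hw => hcon u hu w hw hadj)

/-- The number of components left by the removal of `v`. -/
noncomputable def numComponents (G : SimpleGraph V) (v : V) : ℕ :=
  Nat.card (G.induce ({v}ᶜ : Set V)).ConnectedComponent

/-- Pigeonhole on the components; this is the form in which `d = 2` enters the fork and block
arguments. -/
theorem exists_joins_of_numComponents_le_two [Finite V] (h : numComponents G v ≤ 2)
    (hx : x ≠ v) (hy : y ≠ v) (hz : z ≠ v) :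
    Joins G {v}ᶜ x y ∨ Joins G {v}ᶜ x z ∨ Joins G {v}ᶜ y z := by
  classical
  by_contra! hcon
  obtain ⟨h1, h2, h3⟩ := hcon
  let c (w : V) (hw : w ≠ v) : (G.induce ({v}ᶜ : Set V)).ConnectedComponent :=
    SimpleGraph.connectedComponentMk _ ⟨w, hw⟩
  have hc : ∀ w w' hw hw', ¬ Joins G {v}ᶜ w w' → c w hw ≠ c w' hw' := by
    intro w w' hw hw' hn he
    exact hn ((reachable_iff _ _).1 (SimpleGraph.ConnectedComponent.eq.1 he))
  have : Fintype (G.induce ({v}ᶜ : Set V)).ConnectedComponent := Fintype.ofFinite _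
  have hcard : ({c x hx, c y hy, c z hz} : Finset _).card = 3 :=
    Finset.card_eq_three.2 ⟨_, _, _, hc _ _ _ _ h1, hc _ _ _ _ h2, hc _ _ _ _ h3, rfl⟩
  have := Finset.card_le_univ ({c x hx, c y hy, c z hz} : Finset _)
  rw [hcard, ← Nat.card_eq_fintype_card] at this
  unfold numComponents at h
  omega

end Joins

/-! ### Light sets and the upper bound for `D ≥ 3` -/

section Mass

variable {V : Type u} [Fintype V] {G : SimpleGraph V} {f g : V → ℝ} {S T W : Set V} {v : V}
  {t : ℝ} {D : ℕ}

/-- The total value of the members of `S`. -/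
noncomputable def mass (f : V → ℝ) (S : Set V) : ℝ := ∑ v, S.indicator f v

theorem mass_mono (hf : ∀ v, 0 ≤ f v) (h : S ⊆ T) : mass f S ≤ mass f T :=
  Finset.sum_le_sum fun v _ => Set.indicator_le_indicator_of_subset h hf v

theorem mass_add_compl (f : V → ℝ) (S : Set V) : mass f S + mass f Sᶜ = mass f Set.univ := by
  simp only [mass, ← Finset.sum_add_distrib, Set.indicator_univ]
  exact Finset.sum_congr rfl fun v _ => Set.indicator_self_add_compl_apply S f v

theorem mass_iUnion_le {ι : Type*} [Fintype ι] (hf : ∀ v, 0 ≤ f v) (C : ι → Set V) :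
    mass f (⋃ i, C i) ≤ ∑ i, mass f (C i) := by
  simp only [mass]
  rw [Finset.sum_comm]
  refine Finset.sum_le_sum fun v _ => ?_
  have hnn : ∀ i, 0 ≤ (C i).indicator f v := fun i => Set.indicator_nonneg (fun v _ => hf v) v
  by_cases hv : v ∈ ⋃ i, C i
  · rw [Set.indicator_of_mem hv]
    obtain ⟨i, hi⟩ := Set.mem_iUnion.1 hv
    rw [← Set.indicator_of_mem hi f]
    exact Finset.single_le_sum (f := fun i => (C i).indicator f v) (fun i _ => hnn i)
      (Finset.mem_univ i)
  · rw [Set.indicator_of_notMem hv]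
    exact Finset.sum_nonneg fun i _ => hnn i

theorem mass_union_le (hf : ∀ v, 0 ≤ f v) (S T : Set V) :
    mass f (S ∪ T) ≤ mass f S + mass f T := by
  have := mass_iUnion_le hf fun b : Bool => cond b S T
  rwa [← Set.union_eq_iUnion, Fintype.sum_bool] at this

theorem mass_singleton (f : V → ℝ) (v : V) : mass f {v} = f v := by
  classical
  simp [mass, Set.indicator_apply]

theorem mass_empty (f : V → ℝ) : mass f ∅ = 0 := by simp [mass]

/-- Both agents value `S` at less than `t`. -/
def Light (f g : V → ℝ) (t : ℝ) (S : Set V) : Prop := mass f S < t ∧ mass g S < t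

/-- Two valuations with disjoint supports, each of total value at least `D * t`, such that no
connected allocation gives both agents at least `t`. -/
structure NoGoodCut (G : SimpleGraph V) (f g : V → ℝ) (t : ℝ) (D : ℕ) : Prop where
  left_nonneg : ∀ v, 0 ≤ f v
  right_nonneg : ∀ v, 0 ≤ g v
  disjoint : ∀ v, f v = 0 ∨ g v = 0
  left_total : D * t ≤ mass f Set.univ
  right_total : D * t ≤ mass g Set.univ
  pos : 0 < t
  two_le : 2 ≤ D
  none : ∀ S, Conn G S → Conn G Sᶜ → ¬ (t ≤ mass f S ∧ t ≤ mass g Sᶜ)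

namespace NoGoodCut

variable (h : NoGoodCut G f g t D)
include h

theorem mono_light (hST : S ⊆ T) (hT : Light f g t T) : Light f g t S :=
  ⟨(mass_mono h.left_nonneg hST).trans_lt hT.1, (mass_mono h.right_nonneg hST).trans_lt hT.2⟩

theorem two_mul_le : 2 * t ≤ D * t :=
  mul_le_mul_of_nonneg_right (by exact_mod_cast h.two_le) h.pos.le

/-- Each agent values some side at `t` or more, as the totals are at least `2 * t`. Neither
assignment of the sides satisfies both agents, so both find the same side, and only that one, worth
`t`. -/
theorem light_or (hS : Conn G S) (hS' : Conn G Sᶜ) : Light f g t S ∨ Light f g t Sᶜ := by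
  have h1 := h.none S hS hS'
  have h2 := h.none Sᶜ hS' (by rwa [compl_compl])
  rw [compl_compl] at h2
  have hf := mass_add_compl f S
  have hg := mass_add_compl g S
  have := h.two_mul_le
  have := h.left_total
  have := h.right_total
  simp only [Light]
  grind

/-- One of the agents gives no value to `v`, so for that agent two light sets would make up a total
of at least `2 * t`. -/
theorem not_cover_two (hS : Light f g t S) (hT : Light f g t T)
    (hcov : S ∪ T ∪ {v} = Set.univ) : False := by
  have hf := mass_union_le h.left_nonneg (S ∪ T) {v}
  have hg := mass_union_le h.right_nonneg (S ∪ T) {v}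
  have hf' := mass_union_le h.left_nonneg S T
  have hg' := mass_union_le h.right_nonneg S T
  rw [hcov, mass_singleton] at hf hg
  have := h.two_mul_le
  have := h.left_total
  have := h.right_total
  obtain ⟨h1, h2⟩ := hS
  obtain ⟨h3, h4⟩ := hT
  rcases h.disjoint v with h0 | h0 <;> linarith

theorem not_cover_three (hD : 3 ≤ D) (hS : Light f g t S) (hT : Light f g t T)
    (hW : Light f g t W) (hcov : S ∪ T ∪ W = Set.univ) : False := by
  have hf := mass_union_le h.left_nonneg (S ∪ T) W
  have hf' := mass_union_le h.left_nonneg S T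
  rw [hcov] at hf
  have h3 : 3 * t ≤ D * t := mul_le_mul_of_nonneg_right (by exact_mod_cast hD) h.pos.le
  have := h.left_total
  have := hS.1
  have := hT.1
  have := hW.1
  linarith

/-- Summing over at most `D` components, both agents value the complement of `v` below `D * t`, and
one of them gives `v` no value. -/
theorem not_all_light (hD : numComponents G v ≤ D)
    (hl : ∀ y, y ≠ v → Light f g t (comp G {v}ᶜ y)) : False := by
  classical
  have : Fintype (G.induce ({v}ᶜ : Set V)).ConnectedComponent := Fintype.ofFinite _
  let C (c : (G.induce ({v}ᶜ : Set V)).ConnectedComponent) : Set V := comp G {v}ᶜ c.out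
  have hcov : ({v}ᶜ : Set V) ⊆ ⋃ c, C c := by
    intro y hy
    refine Set.mem_iUnion.2 ⟨SimpleGraph.connectedComponentMk _ ⟨y, hy⟩, ?_⟩
    exact (reachable_iff _ _).1 (SimpleGraph.ConnectedComponent.exact (Quot.out_eq _))
  have key : ∀ e : V → ℝ, (∀ v, 0 ≤ e v) → (∀ c, mass e (C c) < t) →
      mass e {v}ᶜ < D * t := by
    intro e he hlt
    have h1 := (mass_mono he hcov).trans (mass_iUnion_le he C)
    have hpos : 0 < D * t := lt_of_lt_of_le (by linarith [h.pos]) h.two_mul_le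
    rcases isEmpty_or_nonempty (G.induce ({v}ᶜ : Set V)).ConnectedComponent with hE | hE
    · rw [Finset.univ_eq_empty, Finset.sum_empty] at h1
      linarith
    · have h2 : ∑ c, mass e (C c) < ∑ _c : (G.induce ({v}ᶜ : Set V)).ConnectedComponent, t :=
        Finset.sum_lt_sum_of_nonempty Finset.univ_nonempty fun c _ => hlt c
      rw [Finset.sum_const, nsmul_eq_mul, Finset.card_univ, ← Nat.card_eq_fintype_card] at h2
      have h3 : (numComponents G v : ℝ) * t ≤ D * t :=
        mul_le_mul_of_nonneg_right (by exact_mod_cast hD) h.pos.le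
      exact (h1.trans_lt h2).trans_le h3
  have hf := key f h.left_nonneg fun c => (hl _ c.out.2).1
  have hg := key g h.right_nonneg fun c => (hl _ c.out.2).2
  have hf' := mass_add_compl f {v}
  have hg' := mass_add_compl g {v}
  rw [mass_singleton] at hf' hg'
  have := h.left_total
  have := h.right_total
  rcases h.disjoint v with h0 | h0 <;> linarith

omit h in
theorem light_empty (ht : 0 < t) : Light f g t ∅ := by
  simp [Light, mass_empty, ht]

/-- A maximal light set among the connected sets with connected complement. -/
theorem exists_maximal (hS : Conn G S) (hS' : Conn G Sᶜ) (hl : Light f g t S) :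
    ∃ P, S ⊆ P ∧ Conn G P ∧ Conn G Pᶜ ∧ Light f g t P ∧
      ∀ T, P ⊆ T → T ≠ P → Conn G T → Conn G Tᶜ → Light f g t Tᶜ := by
  obtain ⟨P, hSP, hP⟩ := (Set.toFinite {P | Conn G P ∧ Conn G Pᶜ ∧ Light f g t P}).exists_le_maximal
    (show S ∈ {P | Conn G P ∧ Conn G Pᶜ ∧ Light f g t P} from ⟨hS, hS', hl⟩)
  refine ⟨P, hSP, hP.prop.1, hP.prop.2.1, hP.prop.2.2, fun T hPT hne hT hT' => ?_⟩
  exact (h.light_or hT hT').resolve_left fun hTl =>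
    hne ((hP.le_of_ge ⟨hT, hT', hTl⟩ hPT).antisymm hPT)

theorem compl_nonempty (hS : Light f g t S) : Sᶜ.Nonempty := by
  by_contra hne
  rw [Set.not_nonempty_iff_eq_empty, Set.compl_empty_iff] at hne
  have h1 := hS.1
  rw [hne] at h1
  have := h.left_total
  have := h.two_mul_le
  have := h.pos
  linarith

theorem exists_attached (hG : Conn G Set.univ) (hS : Light f g t S) :
    ∃ v ∈ Sᶜ, S.Nonempty → ∃ x ∈ S, G.Adj x v := by
  obtain ⟨v, hv⟩ := h.compl_nonempty hS
  rcases S.eq_empty_or_nonempty with rfl | hne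
  · exact ⟨v, hv, fun h => (Set.not_nonempty_empty h).elim⟩
  · obtain ⟨x, hx, y, hy, hadj⟩ := exists_adj_of_conn_univ hG hne ⟨v, hv⟩
    exact ⟨y, hy, fun _ => ⟨x, hx, hadj⟩⟩

/-- Let `P` be a maximal light side and `v` an outside vertex attached to it (any vertex if `P` is
empty). The components of `Pᶜ \ {v}` are light. Either `P` touches one of them, and then `P`, that
component and the rest are three light sets covering the graph; or `P` touches only `v`, and then
all components of `G - v` are light. -/
theorem false_of_three_le (hG : Conn G Set.univ) (hD : 3 ≤ D)
    (hcomp : ∀ v, numComponents G v ≤ D) : False := by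
  obtain ⟨P, -, hP, hP', hPl, hmax⟩ := h.exists_maximal (S := ∅) conn_empty
    (by rwa [Set.compl_empty]) (light_empty h.pos)
  obtain ⟨v, hv, hatt⟩ := h.exists_attached hG hPl
  have hvC : ∀ y, v ∉ comp G (Pᶜ \ {v}) y := fun y hy => (comp_subset hy).2 rfl
  have hrest : ∀ y, Conn G (Pᶜ \ comp G (Pᶜ \ {v}) y) := fun y =>
    hP'.diff_closed hv (hvC y) fun u w hu hadj hw hwv => comp_closed hu hadj ⟨hw, hwv⟩
  -- The complement of such a component is `P` glued at `v` to the rest of `Pᶜ`. It is connected and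
  -- strictly larger than `P`, so maximality makes the component light.
  have hlight : ∀ y, Light f g t (comp G (Pᶜ \ {v}) y) := by
    intro y
    have hc : (comp G (Pᶜ \ {v}) y)ᶜ = P ∪ (Pᶜ \ comp G (Pᶜ \ {v}) y) := by
      ext z
      have := fun hz : z ∈ comp G (Pᶜ \ {v}) y => (comp_subset hz).1
      simp only [Set.mem_compl_iff, Set.mem_union, Set.mem_sdiff] at this ⊢
      tauto
    have := hmax (comp G (Pᶜ \ {v}) y)ᶜ (by rw [hc]; exact Set.subset_union_left)
      (fun he => hv (he ▸ hvC y)) ?_ (by rw [compl_compl]; exact conn_comp)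
    · rwa [compl_compl] at this
    rw [hc]
    rcases P.eq_empty_or_nonempty with rfl | hne
    · rw [Set.empty_union]; exact hrest y
    · obtain ⟨x, hx, hadj⟩ := hatt hne
      exact hP.union (hrest y) hx ⟨hv, hvC y⟩ hadj
  by_cases hadj : ∃ x ∈ P, ∃ y ∈ Pᶜ \ {v}, G.Adj x y
  · obtain ⟨x, hx, y, hy, hadj⟩ := hadj
    have hyC := mem_comp_self (G := G) hy
    have hc : (P ∪ comp G (Pᶜ \ {v}) y)ᶜ = Pᶜ \ comp G (Pᶜ \ {v}) y := Set.compl_union _ _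
    have hl := hmax (P ∪ comp G (Pᶜ \ {v}) y) Set.subset_union_left
      (fun he => hy.1 (he ▸ Set.mem_union_right _ hyC))
      (hP.union conn_comp hx hyC hadj) (hc ▸ hrest y)
    refine h.not_cover_three hD hPl (hlight y) hl ?_
    exact Set.union_compl_self _
  · push Not at hadj
    refine h.not_all_light (hcomp v) fun y hy => ?_
    by_cases hyP : y ∈ P
    · refine h.mono_light (fun z hz => ?_) hPl
      exact Joins.mem_of_closed hz hyP fun u w hu huw hw =>
        by_contra fun hwP => hadj u hu w ⟨hwP, hw⟩ huw
    · refine h.mono_light (fun z hz => ?_) (hlight y)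
      exact Joins.mem_of_closed hz (mem_comp_self ⟨hyP, hy⟩) fun u w hu huw hw =>
        comp_closed hu huw ⟨fun hwP => hadj w hwP u (comp_subset hu) huw.symm, hw⟩

end NoGoodCut

end Mass

/-! ### Forks as the only obstruction for `D = 2` -/

section Fork

variable {V : Type u} {G : SimpleGraph V} {f g : V → ℝ} {P Q : Set V} {v x y : V}
  {t : ℝ} {D : ℕ}

/-- Three cut vertices `a i`, each of which separates some vertex `x i` from the other two. -/
def HasFork (G : SimpleGraph V) : Prop :=
  ∃ a x : Fin 3 → V, Function.Injective a ∧ (∀ i, x i ≠ a i) ∧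
    ∀ i j, i ≠ j → ¬ Joins G {a i}ᶜ (x i) (a j)

/-- Suppose that each vertex of a connected set `Q` that belongs to `N` is a cut vertex of `Q`.
Then each component left by the removal of a member of `N` contains such a component without
members of `N`. -/
theorem exists_component_avoiding [Finite V] {N : Set V} (hQ : Conn G Q) (hNQ : N ⊆ Q)
    (hcut : ∀ v ∈ N, ¬ Conn G (Q \ {v})) (hv : v ∈ N) (hy : y ∈ Q \ {v}) :
    ∃ w ∈ N, w ∈ comp G (Q \ {v}) y ∪ {v} ∧ ∃ z ∈ Q \ {w},
      comp G (Q \ {w}) z ⊆ comp G (Q \ {v}) y ∧ ∀ n ∈ N, n ∉ comp G (Q \ {w}) z := by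
  induction hk : (comp G (Q \ {v}) y).ncard using Nat.strong_induction_on generalizing v y with
  | _ k ih =>
  by_cases hC : ∀ n ∈ N, n ∉ comp G (Q \ {v}) y
  · exact ⟨v, hv, .inr rfl, y, hy, le_rfl, hC⟩
  push Not at hC
  obtain ⟨n, hn, hnC⟩ := hC
  have hnv : n ≠ v := (comp_subset hnC).2
  obtain ⟨z, hz, hzv⟩ : ∃ z ∈ Q \ {n}, ¬ Joins G (Q \ {n}) z v := by
    by_contra! hcon
    exact hcut n hn (Conn.of_center hcon)
  have hvC : v ∉ comp G (Q \ {n}) z := hzv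
  -- The component cut off by `n` on the side away from `v` is connected to `n` without using `v`.
  -- Hence it lies in the old component, which moreover contains `n`, so the size drops.
  have hsub' : comp G (Q \ {n}) z ∪ {n} ⊆ Q \ {v} := by
    rintro w (hw | rfl)
    · exact ⟨(comp_subset hw).1, fun hwv => hvC (hwv ▸ hw)⟩
    · exact ⟨hNQ hn, hnv⟩
  have hconn : Conn G (comp G (Q \ {n}) z ∪ {n}) := by
    refine Conn.of_center (v := n) ?_
    rintro w (hw | rfl)
    · exact ((conn_comp w hw z (mem_comp_self hz)).mono Set.subset_union_left).trans
        (hQ.joins_center (hNQ hn) hz.1 hz.2)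
    · exact .refl (.inr rfl)
  have hsub : comp G (Q \ {n}) z ∪ {n} ⊆ comp G (Q \ {v}) y := fun w hw =>
    Joins.trans hnC (hconn.subset_comp hsub' (.inr rfl) hw)
  have hlt : (comp G (Q \ {n}) z).ncard < k := by
    rw [← hk]
    exact Set.ncard_lt_ncard ⟨fun w hw => hsub (.inl hw), fun hle => (comp_subset (hle hnC)).2 rfl⟩
      (Set.toFinite _)
  obtain ⟨w, hw, hw', s, hs, hs', hs''⟩ := ih _ hlt hn hz rfl
  exact ⟨w, hw, .inl (hsub hw'), s, hs, fun r hr => hsub (.inl (hs' hr)), hs''⟩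

theorem injective_vecCons_three {α : Type*} {a b c : α} (hab : a ≠ b) (hac : a ≠ c)
    (hbc : b ≠ c) : Function.Injective ![a, b, c] := by
  intro i j hij
  fin_cases i <;> fin_cases j <;> simp_all

/-- A maximal light side `P` is grown from a light component at the cut vertex `a`. Every outside
neighbour of `P` is a cut vertex of `Pᶜ`, and two end components of `Pᶜ` that miss these neighbours
supply the other two prongs. -/
theorem NoGoodCut.hasFork [Fintype V] (h : NoGoodCut G f g t D) (hG : Conn G Set.univ)
    (hcomp : ∀ v, numComponents G v ≤ 2) {a : V} (ha : ¬ Conn G {a}ᶜ) : HasFork G := by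
  have hcompl : ∀ y, Conn G (comp G {a}ᶜ y)ᶜ := fun y => by
    rw [Set.compl_eq_univ_sdiff]
    exact hG.diff_closed trivial (fun hy => comp_subset hy rfl)
      fun u w hu hadj _ hw => comp_closed hu hadj hw
  -- If one component at `a` is not light, its complement is, and that contains another component.
  obtain ⟨x, hx, hxl⟩ : ∃ x ≠ a, Light f g t (comp G {a}ᶜ x) := by
    by_contra! hcon
    obtain ⟨y, hy⟩ : ∃ y, y ≠ a := by
      by_contra! hcon
      exact ha fun x hx => (hx (hcon x)).elim
    have hyl := (h.light_or conn_comp (hcompl y)).resolve_left (hcon y hy)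
    obtain ⟨z, hz, hzy⟩ : ∃ z ∈ ({a}ᶜ : Set V), ¬ Joins G {a}ᶜ z y := by
      by_contra! hcon
      exact ha (Conn.of_center hcon)
    exact hcon z hz (h.mono_light (fun w hw hw' => hzy (Joins.trans hw (Joins.symm hw'))) hyl)
  obtain ⟨P, hxP, hP, hP', hPl, hmax⟩ := h.exists_maximal conn_comp (hcompl x) hxl
  have hxx : x ∈ comp G {a}ᶜ x := mem_comp_self hx
  have hxP' : x ∈ P := hxP hxx
  let N : Set V := {v ∈ Pᶜ | ∃ p ∈ P, G.Adj p v}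
  -- Otherwise `P ∪ {v}` would be a larger connected side with connected complement. That complement
  -- would be light, and together with `P` it covers everything but `v`.
  have hcut : ∀ v ∈ N, ¬ Conn G (Pᶜ \ {v}) := by
    rintro v ⟨hv, p, hp, hadj⟩ hconn
    have hc : (P ∪ {v})ᶜ = Pᶜ \ {v} := Set.compl_union _ _
    have hl := hmax (P ∪ {v}) Set.subset_union_left (fun he => hv (he ▸ Set.mem_union_right _ rfl))
      (hP.insert fun _ => ⟨p, hp, hadj⟩) (by rwa [hc])
    refine h.not_cover_two (v := v) hPl hl ?_
    rw [Set.union_right_comm]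
    exact Set.union_compl_self _
  obtain ⟨v, hv, hatt⟩ := h.exists_attached hG hPl
  have hvN : v ∈ N := ⟨hv, hatt ⟨x, hxP'⟩⟩
  obtain ⟨y₁, hy₁, y₂, hy₂, hy⟩ : ∃ y₁ ∈ Pᶜ \ {v}, ∃ y₂ ∈ Pᶜ \ {v}, ¬ Joins G (Pᶜ \ {v}) y₁ y₂ := by
    by_contra! hcon
    exact hcut v hvN hcon
  have hdisj : ∀ w, w ∈ comp G (Pᶜ \ {v}) y₁ → w ∉ comp G (Pᶜ \ {v}) y₂ :=
    fun w h1 h2 => hy (Joins.trans h1 (Joins.symm h2))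
  have hNP : N ⊆ Pᶜ := fun w hw => hw.1
  obtain ⟨v₁, hv₁, hv₁C, z₁, hz₁, hz₁C, hz₁N⟩ := exists_component_avoiding hP' hNP hcut hvN hy₁
  obtain ⟨v₂, hv₂, hv₂C, z₂, hz₂, hz₂C, hz₂N⟩ := exists_component_avoiding hP' hNP hcut hvN hy₂
  -- A component of `Pᶜ \ {w}` without neighbours of `P` is already a full component of `G - w`.
  have hend : ∀ w z, z ∈ Pᶜ \ {w} → (∀ n ∈ N, n ∉ comp G (Pᶜ \ {w}) z) →
      ∀ s, Joins G {w}ᶜ z s → s ∈ comp G (Pᶜ \ {w}) z := fun w z hz hN s hs =>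
    hs.mem_of_closed (mem_comp_self hz) fun u r hu hadj hr => comp_closed hu hadj
      ⟨fun hrP => hN u ⟨(comp_subset hu).1, r, hrP, hadj.symm⟩ hu, hr⟩
  have hend₁ := hend v₁ z₁ hz₁ hz₁N
  have hend₂ := hend v₂ z₂ hz₂ hz₂N
  -- If they coincided, `z₁`, `z₂` and `x` would lie in three different components left by that
  -- vertex.
  have hne : v₁ ≠ v₂ := by
    rintro rfl
    have hxv : x ≠ v₁ := fun he => hv₁.1 (he ▸ hxP')
    rcases exists_joins_of_numComponents_le_two (hcomp v₁) hz₁.2 hz₂.2 hxv with hj | hj | hj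
    · exact hdisj z₂ (hz₁C (hend₁ _ hj)) (hz₂C (mem_comp_self hz₂))
    · exact (comp_subset (hend₁ _ hj)).1 hxP'
    · exact (comp_subset (hend₂ _ hj)).1 hxP'
  -- Without `a`, the connected set `P` would be just the component of `x`, whose only possible
  -- outside neighbour is `a`; this would force `v₁ = v₂`.
  have haP : a ∈ P := by
    by_contra haP
    have hPx : P ⊆ comp G {a}ᶜ x :=
      hP.subset_comp (fun p hp hpa => haP (by rwa [← show p = a from hpa])) hxP'
    have hNa : ∀ w ∈ N, w = a := by
      rintro w ⟨hw, p, hp, hadj⟩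
      by_contra hwa
      exact hw (hxP (comp_closed (hPx hp) hadj hwa))
    exact hne ((hNa _ hv₁).trans (hNa _ hv₂).symm)
  have hv₁a : v₁ ≠ a := fun he => hv₁.1 (he ▸ haP)
  have hv₂a : v₂ ≠ a := fun he => hv₂.1 (he ▸ haP)
  refine ⟨![a, v₁, v₂], ![x, z₁, z₂], ?_, ?_, ?_⟩
  · exact injective_vecCons_three hv₁a.symm hv₂a.symm hne
  · intro i
    fin_cases i
    · exact hx
    · exact hz₁.2
    · exact hz₂.2
  · have h01 : ¬ Joins G {a}ᶜ x v₁ := fun hj => hv₁.1 (hxP hj)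
    have h02 : ¬ Joins G {a}ᶜ x v₂ := fun hj => hv₂.1 (hxP hj)
    have h10 : ¬ Joins G {v₁}ᶜ z₁ a := fun hj => (comp_subset (hend₁ _ hj)).1 haP
    have h20 : ¬ Joins G {v₂}ᶜ z₂ a := fun hj => (comp_subset (hend₂ _ hj)).1 haP
    have h12 : ¬ Joins G {v₁}ᶜ z₁ v₂ := fun hj => by
      rcases hv₂C with hv₂C | rfl
      · exact hdisj _ (hz₁C (hend₁ _ hj)) hv₂C
      · exact hz₁N _ hv₂ (hend₁ _ hj)
    have h21 : ¬ Joins G {v₂}ᶜ z₂ v₁ := fun hj => by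
      rcases hv₁C with hv₁C | rfl
      · exact hdisj _ hv₁C (hz₂C (hend₂ _ hj))
      · exact hz₂N _ hv₁ (hend₂ _ hj)
    intro i j hij
    fin_cases i <;> fin_cases j <;> first | exact (hij rfl).elim | assumption

end Fork

/-! ### From cuts to the price of connectivity: upper and lower bounds -/

section Bounds

variable {V : Type u} [Fintype V] {G : SimpleGraph V} {D : ℕ}

theorem egalWelfare_eq_min (U : UtilityProfile V 2) (a : Allocation V 2) :
    egalWelfare U a =
      ((min (∑ g with a g = 0, U.util 0 g) (∑ g with a g = 1, U.util 1 g) : ℝ≥0) : ℝ≥0∞) := by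
  rw [ENNReal.coe_min]
  refine le_antisymm (le_min (iInf_le _ 0) (iInf_le _ 1)) (le_iInf fun i => ?_)
  fin_cases i
  · exact min_le_left _ _
  · exact min_le_right _ _

theorem egalPoC_le (hD : 2 ≤ D) (H : ∀ f g t, ¬ NoGoodCut G f g t D) :
    egalPoC G 2 ≤ D := by
  classical
  refine iSup_le fun U => ?_
  suffices h : optEgal U ≤ D * optEgalConnected G U by
    unfold egalRatio
    split_ifs
    · exact_mod_cast (by omega : 1 ≤ D)
    · exact ENNReal.div_le_of_le_mul h
  refine iSup_le fun a => ?_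
  rw [egalWelfare_eq_min]
  set w : ℝ≥0 := min (∑ g with a g = 0, U.util 0 g) (∑ g with a g = 1, U.util 1 g) with hw
  rcases eq_or_ne w 0 with h0 | h0
  · simp [h0]
  have hDpos : (0 : ℝ) < D := by exact_mod_cast (by omega : 0 < D)
  have hwpos : (0 : ℝ) < w := by exact_mod_cast pos_iff_ne_zero.2 h0
  -- Truncation to the agent's own bundle makes the supports disjoint and only lowers the value of
  -- any other bundle.
  let e (i : Fin 2) (v : V) : ℝ := if a v = i then U.util i v else 0
  have hnn : ∀ i v, 0 ≤ e i v := fun i v => by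
    simp only [e]
    split_ifs
    · exact NNReal.coe_nonneg _
    · exact le_rfl
  have htot : ∀ i, mass (e i) Set.univ = ((∑ g with a g = i, U.util i g : ℝ≥0) : ℝ) := fun i => by
    simp [mass, e, Finset.sum_filter, apply_ite ((↑) : ℝ≥0 → ℝ)]
  obtain ⟨S, hS, hS', h1, h2⟩ : ∃ S, Conn G S ∧ Conn G Sᶜ ∧
      (w / D : ℝ) ≤ mass (e 0) S ∧ (w / D : ℝ) ≤ mass (e 1) Sᶜ := by
    by_contra! hcon
    refine H (e 0) (e 1) (w / D) ⟨hnn 0, hnn 1, fun v => ?_, ?_, ?_, by positivity, hD,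
      fun S hS hS' hle => (hcon S hS hS' hle.1).not_ge hle.2⟩
    · by_cases hv : a v = 0
      · right; simp [e, hv]
      · left; simp [e, hv]
    · rw [mul_div_cancel₀ _ hDpos.ne', htot]
      exact_mod_cast min_le_left _ _
    · rw [mul_div_cancel₀ _ hDpos.ne', htot]
      exact_mod_cast min_le_right _ _
  let b : Allocation V 2 := fun v => if v ∈ S then 0 else 1
  have hb0 : {v | b v = 0} = S := by ext v; by_cases hv : v ∈ S <;> simp [b, hv]
  have hb1 : {v | b v = 1} = Sᶜ := by ext v; by_cases hv : v ∈ S <;> simp [b, hv]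
  have hb : IsConnectedAllocation G b := by
    intro i
    rw [← conn_iff]
    fin_cases i
    · exact hb0 ▸ hS
    · exact hb1 ▸ hS'
  have hbound : ∀ i (T : Set V), {v | b v = i} = T →
      mass (e i) T ≤ ((∑ g with b g = i, U.util i g : ℝ≥0) : ℝ) := by
    rintro i T rfl
    rw [NNReal.coe_sum, Finset.sum_filter]
    refine Finset.sum_le_sum fun v _ => ?_
    by_cases hv : b v = i
    · rw [Set.indicator_of_mem (by exact hv), if_pos hv]
      simp only [e]
      split_ifs
      · exact le_rfl
      · exact NNReal.coe_nonneg _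
    · rw [Set.indicator_of_notMem (by exact hv), if_neg hv]
  have hmin : w ≤ D * min (∑ g with b g = 0, U.util 0 g) (∑ g with b g = 1, U.util 1 g) := by
    have h1' := h1.trans (hbound 0 S hb0)
    have h2' := h2.trans (hbound 1 Sᶜ hb1)
    rw [div_le_iff₀' hDpos] at h1' h2'
    rw [mul_min_of_nonneg _ _ (zero_le)]
    exact le_min (by exact_mod_cast h1') (by exact_mod_cast h2')
  calc (w : ℝ≥0∞) ≤ D * egalWelfare U b := by
        rw [egalWelfare_eq_min]; exact_mod_cast hmin
    _ ≤ D * optEgalConnected G U := by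
        gcongr
        exact le_iSup (fun a : {a : Allocation V 2 // IsConnectedAllocation G a} =>
          egalWelfare U a.1) ⟨b, hb⟩

/-- The valuation that spreads the value `1` evenly over `A`. -/
noncomputable def uniformUtil [DecidableEq V] (A : Finset V) (v : V) : ℝ≥0 :=
  if v ∈ A then (A.card : ℝ≥0)⁻¹ else 0

omit [Fintype V] in
theorem sum_uniformUtil [DecidableEq V] (A B : Finset V) :
    ∑ v ∈ B, uniformUtil A v = ((B ∩ A).card : ℝ≥0) * (A.card : ℝ≥0)⁻¹ := by
  simp only [uniformUtil]
  rw [Finset.sum_ite_mem, Finset.sum_const, nsmul_eq_mul]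

/-- If the two agents spread their value evenly over disjoint sets `A` and `R`, and each
connected allocation gives at most the fraction `1 / D` to one of them, then the price of
connectivity is at least `D`. -/
theorem le_egalPoC [DecidableEq V] {A R : Finset V} (hA : A.Nonempty)
    (hR : R.Nonempty) (hAR : Disjoint A R)
    (hD : 0 < D)
    (H : ∀ S : Finset V, Conn G S → Conn G (S : Set V)ᶜ →
      (S ∩ A).card * D ≤ A.card ∨ (Sᶜ ∩ R).card * D ≤ R.card) :
    (D : ℝ≥0∞) ≤ egalPoC G 2 := by
  have hcard : ∀ {B : Finset V}, B.Nonempty → (B.card : ℝ≥0) ≠ 0 := fun hB =>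
    Nat.cast_ne_zero.2 hB.card_ne_zero
  let U : UtilityProfile V 2 :=
    ⟨![uniformUtil A, uniformUtil R], fun i => by
      fin_cases i
      · simp only [Fin.zero_eta, Matrix.cons_val_zero]
        rw [sum_uniformUtil, Finset.univ_inter, mul_inv_cancel₀ (hcard hA)]
      · simp only [Fin.mk_one, Matrix.cons_val_one, Matrix.cons_val_fin_one]
        rw [sum_uniformUtil, Finset.univ_inter, mul_inv_cancel₀ (hcard hR)]⟩
  have hU0 : U.util 0 = uniformUtil A := rfl
  have hU1 : U.util 1 = uniformUtil R := rfl
  have hopt : 1 ≤ optEgal U := by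
    refine le_trans ?_ (le_iSup _ (fun v => if v ∈ A then 0 else 1 : Allocation V 2))
    rw [egalWelfare_eq_min, hU0, hU1, sum_uniformUtil, sum_uniformUtil]
    have h1 : ({g | (if g ∈ A then (0 : Fin 2) else 1) = 0} : Finset V) ∩ A = A := by
      ext g; by_cases hg : g ∈ A <;> simp [hg]
    have h2 : ({g | (if g ∈ A then (0 : Fin 2) else 1) = 1} : Finset V) ∩ R = R := by
      ext g
      have := fun hg : g ∈ A => Finset.disjoint_left.1 hAR hg
      by_cases hg : g ∈ A <;> simp_all
    rw [h1, h2, mul_inv_cancel₀ (hcard hA), mul_inv_cancel₀ (hcard hR)]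
    simp
  have hDpos : (0 : ℝ≥0) < D := by exact_mod_cast hD
  have hconn : optEgalConnected G U ≤ ((D : ℝ≥0)⁻¹ : ℝ≥0) := by
    refine iSup_le fun ⟨b, hb⟩ => ?_
    rw [egalWelfare_eq_min, hU0, hU1, sum_uniformUtil, sum_uniformUtil, ENNReal.coe_le_coe]
    have hc : ({g | b g = 0} : Finset V)ᶜ = ({g | b g = 1} : Finset V) := by
      ext g
      simp only [Finset.mem_compl, Finset.mem_filter, Finset.mem_univ, true_and]
      generalize b g = i
      revert i
      decide
    have hcoe : ∀ i, (({g | b g = i} : Finset V) : Set V) = {g | b g = i} := fun i => by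
      ext g; simp
    have hS := conn_iff.2 (hb 0)
    have hS' := conn_iff.2 (hb 1)
    have key : ∀ B C : Finset V, C.Nonempty → (B ∩ C).card * D ≤ C.card →
        ((B ∩ C).card : ℝ≥0) * (C.card : ℝ≥0)⁻¹ ≤ (D : ℝ≥0)⁻¹ := by
      intro B C hC hle
      rw [← div_eq_mul_inv, div_le_iff₀ (pos_iff_ne_zero.2 (hcard hC)), inv_mul_eq_div,
        le_div_iff₀ hDpos]
      exact_mod_cast hle
    have := H ({g | b g = 0} : Finset V) (by rwa [hcoe]) (by
      rwa [← Finset.coe_compl, hc, hcoe])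
    rw [hc] at this
    rcases this with h | h
    · exact (min_le_left _ _).trans (key _ _ hA h)
    · exact (min_le_right _ _).trans (key _ _ hR h)
  refine le_trans ?_ (le_iSup _ U)
  unfold egalRatio
  rw [if_neg fun h => by simp [h.1] at hopt]
  calc (D : ℝ≥0∞) = 1 / ((D : ℝ≥0)⁻¹ : ℝ≥0) := by
        rw [ENNReal.coe_inv hDpos.ne']; simp
    _ ≤ _ := ENNReal.div_le_div hopt hconn

/-- One agent wants only `v`, the other one representative of each component of `G - v`. Once the
first agent holds `v`, a connected bundle of the other stays in a single component. -/
theorem numComponents_le_egalPoC {v : V} (hv : 0 < numComponents G v) :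
    (numComponents G v : ℝ≥0∞) ≤ egalPoC G 2 := by
  classical
  have : Fintype (G.induce ({v}ᶜ : Set V)).ConnectedComponent := Fintype.ofFinite _
  let r (c : (G.induce ({v}ᶜ : Set V)).ConnectedComponent) : V := c.out.1
  have hr : ∀ c c', Joins G {v}ᶜ (r c) (r c') → c = c' := by
    intro c c' hj
    rw [← c.out_eq, ← c'.out_eq]
    exact SimpleGraph.ConnectedComponent.sound ((reachable_iff _ _).2 hj)
  have hrv : ∀ c, r c ≠ v := fun c => c.out.2
  have hinj : Function.Injective r := fun c c' h => hr c c' (h ▸ .refl (hrv c))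
  have hcard : (Finset.univ.image r).card = numComponents G v := by
    rw [Finset.card_image_of_injective _ hinj, Finset.card_univ, ← Nat.card_eq_fintype_card]
    rfl
  refine le_egalPoC (A := {v}) (R := Finset.univ.image r) (Finset.singleton_nonempty v)
    (Finset.card_pos.1 (hcard ▸ hv)) (by simpa using hrv) hv fun S _ hS' => ?_
  rw [hcard]
  by_cases hvS : v ∈ S
  · right
    refine Nat.mul_le_of_le_div _ _ _ ?_
    rw [Nat.div_self hv, Finset.card_le_one]
    intro x hx y hy
    simp only [Finset.mem_inter, Finset.mem_compl, Finset.mem_image, Finset.mem_univ,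
      true_and] at hx hy
    obtain ⟨hxS, c, rfl⟩ := hx
    obtain ⟨hyS, c', rfl⟩ := hy
    rw [hr c c' ((hS' _ hxS _ hyS).mono
      (Set.compl_subset_compl.2 (Set.singleton_subset_iff.2 hvS)))]
  · left
    rw [Finset.inter_singleton_of_notMem hvS]
    simp

/-- One agent wants the `a i`, the other the `x i`. A connected bundle with two of the `x i` must
contain the two corresponding `a i`, which leaves at most one for the first agent. -/
theorem HasFork.three_le_egalPoC (hG : Conn G Set.univ) (h : HasFork G) :
    (3 : ℝ≥0∞) ≤ egalPoC G 2 := by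
  classical
  obtain ⟨a, x, hinj, hxa, hsep⟩ := h
  -- The walk from `x j` to `a j` can be kept in the component of `x j` at `a j`, and `a i` is not
  -- in that component.
  have hjoin : ∀ i j, i ≠ j → Joins G {a i}ᶜ (x j) (a j) := by
    intro i j hij
    have := hG.joins_center (v := a j) trivial trivial (hxa j)
    rw [← Set.compl_eq_univ_sdiff] at this
    refine this.mono ?_
    rintro w (hw | rfl)
    · rintro rfl
      exact hsep j i hij.symm hw
    · exact fun he => hij (hinj he.symm)
  have hnot : ∀ i j, i ≠ j → ¬ Joins G {a i}ᶜ (x i) (x j) := fun i j hij hj =>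
    hsep i j hij (hj.trans (hjoin i j hij))
  have hxinj : Function.Injective x := fun i j he => by
    by_contra hij
    exact hnot i j hij (he ▸ .refl (hxa i))
  have hxa' : ∀ i j, x i ≠ a j := by
    intro i j he
    by_cases hij : i = j
    · exact hxa i (hij ▸ he)
    · exact hsep i j hij (he ▸ .refl (hxa i))
  have hcard : ∀ e : Fin 3 → V, Function.Injective e → (Finset.univ.image e).card = 3 := by
    intro e he
    rw [Finset.card_image_of_injective _ he, Finset.card_univ, Fintype.card_fin]
  refine le_egalPoC (D := 3) (A := Finset.univ.image a) (R := Finset.univ.image x)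
    (Finset.univ_nonempty.image a) (Finset.univ_nonempty.image x) ?_ (by norm_num)
    fun S _ hS' => ?_
  · rw [Finset.disjoint_left]
    simp only [Finset.mem_image, Finset.mem_univ, true_and]
    rintro _ ⟨j, rfl⟩ ⟨i, hi⟩
    exact hxa' i j hi
  rw [hcard a hinj, hcard x hxinj]
  by_cases hR : (Sᶜ ∩ Finset.univ.image x).card ≤ 1
  · right; omega
  left
  suffices hle : (S ∩ Finset.univ.image a).card ≤ 1 by omega
  rw [not_le, Finset.one_lt_card] at hR
  obtain ⟨p, hp, q, hq, hpq⟩ := hR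
  simp only [Finset.mem_inter, Finset.mem_compl, Finset.mem_image, Finset.mem_univ,
    true_and] at hp hq
  obtain ⟨hp, i, rfl⟩ := hp
  obtain ⟨hq, j, rfl⟩ := hq
  have hij : i ≠ j := fun he => hpq (he ▸ rfl)
  have hmem : ∀ k l, k ≠ l → x k ∉ S → x l ∉ S → a k ∉ S := by
    intro k l hkl hk hl hak
    exact hnot k l hkl ((hS' _ hk _ hl).mono
      (Set.compl_subset_compl.2 (Set.singleton_subset_iff.2 hak)))
  have hi := hmem i j hij hp hq
  have hj := hmem j i hij.symm hq hp
  rw [Finset.card_le_one]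
  intro y hy z hz
  simp only [Finset.mem_inter, Finset.mem_image, Finset.mem_univ, true_and] at hy hz
  obtain ⟨hy, k, rfl⟩ := hy
  obtain ⟨hz, l, rfl⟩ := hz
  have h1 : k ≠ i := fun he => hi (he ▸ hy)
  have h2 : k ≠ j := fun he => hj (he ▸ hy)
  have h3 : l ≠ i := fun he => hi (he ▸ hz)
  have h4 : l ≠ j := fun he => hj (he ▸ hz)
  congr 1
  omega

end Bounds

/-! ### Blocks as maximal inseparable sets, and when their tree is a path -/

section Blocks

variable {V : Type u} {G : SimpleGraph V} {S X Y : Set V} {x y z u v : V}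

/-- No single vertex separates `x` from `y`. -/
def Insep (G : SimpleGraph V) (x y : V) : Prop :=
  ∀ a, a ≠ x → a ≠ y → Joins G {a}ᶜ x y

/-- A set of pairwise inseparable vertices. -/
def IsInsepSet (G : SimpleGraph V) (X : Set V) : Prop :=
  ∀ x ∈ X, ∀ y ∈ X, Insep G x y

theorem Insep.refl (x : V) : Insep G x x := fun _ h _ => Joins.refl h.symm

theorem Insep.symm (h : Insep G x y) : Insep G y x := fun a h1 h2 => (h a h2 h1).symm

theorem Insep.of_adj (h : G.Adj x y) : Insep G x y := fun _ h1 h2 =>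
  Joins.of_adj h h1.symm h2.symm

theorem IsInsepSet.singleton (x : V) : IsInsepSet G {x} := by
  rintro _ rfl _ rfl
  exact .refl _

theorem IsInsepSet.insert (hX : IsInsepSet G X) (h : ∀ x ∈ X, Insep G z x) :
    IsInsepSet G (insert z X) := by
  rintro _ (rfl | hx) _ (rfl | hy)
  · exact .refl _
  · exact h _ hy
  · exact (h _ hx).symm
  · exact hX _ hx _ hy

theorem IsInsepSet.pair (h : G.Adj x y) : IsInsepSet G {x, y} :=
  (IsInsepSet.singleton y).insert (by rintro _ rfl; exact .of_adj h)

theorem IsInsepSet.exists_maximal [Finite V] (hX : IsInsepSet G X) :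
    ∃ Y, X ⊆ Y ∧ Maximal (IsInsepSet G) Y :=
  (Set.toFinite {Y | IsInsepSet G Y}).exists_le_maximal hX

theorem mem_of_maximal_isInsepSet (hX : Maximal (IsInsepSet G) X) (h : ∀ x ∈ X, Insep G z x) :
    z ∈ X :=
  hX.le_of_ge (hX.prop.insert h) (Set.subset_insert z X) (Set.mem_insert z X)

/-- A path between two members of a maximal set of inseparable vertices stays in that set. -/
theorem Joins.inter_of_maximal (hX : Maximal (IsInsepSet G) X) (hx : x ∈ X) (hy : y ∈ X)
    (h : Joins G S x y) : Joins G (S ∩ X) x y := by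
  classical
  obtain ⟨p, hp⟩ := h
  refine ⟨p.bypass, fun z hz => ⟨hp z (p.support_bypass_subset_support hz), ?_⟩⟩
  refine mem_of_maximal_isInsepSet hX fun w hw a haz haw => ?_
  have hnd := p.bypass_isPath.support_nodup
  rw [← p.bypass.take_spec hz, SimpleGraph.Walk.support_append] at hnd
  -- On a simple path a vertex `a ≠ z` lies on only one side of `z`. The other side still leads from
  -- `z` to an end in `X`, and from there to `w`, all avoiding `a`.
  by_cases ha : a ∈ (p.bypass.takeUntil z hz).support
  · have ha' : a ∉ (p.bypass.dropUntil z hz).support := fun ha' => by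
      rw [SimpleGraph.Walk.mem_support_iff] at ha'
      exact (List.nodup_append.1 hnd).2.2 a ha a (ha'.resolve_left haz) rfl
    have hzy : Joins G {a}ᶜ z y :=
      ⟨p.bypass.dropUntil z hz, fun s hs hsa => ha' (by rwa [← show s = a from hsa])⟩
    exact hzy.trans (hX.prop y hy w hw a (fun he => hzy.right_mem he.symm) haw)
  · have hzx : Joins G {a}ᶜ z x := Joins.symm
      ⟨p.bypass.takeUntil z hz, fun s hs hsa => ha (by rwa [← show s = a from hsa])⟩
    exact hzx.trans (hX.prop x hx w hw a (fun he => hzx.right_mem he.symm) haw)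

theorem ConnectivityAtLeast.isInsepSet [Finite V] {H : G.Subgraph}
    (h : ConnectivityAtLeast H.coe 2) : IsInsepSet G H.verts := by
  classical
  intro x hx y hy a hax hay
  have : Fintype H.verts := Fintype.ofFinite _
  -- This set is empty when `a` lies outside `H`, so its size is at most one rather than equal to
  -- one.
  let S : Finset H.verts := {w | w.1 = a}
  have hpre : (H.coe.induce ((S : Set H.verts)ᶜ)).Preconnected := by
    by_contra hn
    have h2 := h _ ⟨S, rfl, hn⟩
    have h1 : S.card ≤ 1 := Finset.card_le_one.2 fun p hp q hq => Subtype.ext <| by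
      simp only [S, Finset.mem_filter, Finset.mem_univ, true_and] at hp hq
      rw [hp, hq]
    omega
  obtain ⟨p⟩ := hpre ⟨⟨x, hx⟩, by simpa [S] using hax.symm⟩ ⟨⟨y, hy⟩, by simpa [S] using hay.symm⟩
  refine Joins.of_hom (H.hom.comp (SimpleGraph.Embedding.induce _).toHom) p fun w _ => ?_
  have := w.2
  simpa [S] using this

/-- Inseparability only provides walks in `G`; by `Joins.inter_of_maximal` they can be replaced by
walks inside `X` that still avoid the removed vertex. -/
theorem connectivityAtLeast_of_maximal (hG : Conn G Set.univ)
    (hX : Maximal (IsInsepSet G) X) :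
    ConnectivityAtLeast ((⊤ : G.Subgraph).induce X).coe 2 := by
  rintro _ ⟨S, rfl, hS⟩
  by_contra! hlt
  refine hS fun ⟨⟨x, hx⟩, hxS⟩ ⟨⟨y, hy⟩, hyS⟩ => ?_
  have hx' : x ∈ X := hx
  have hy' : y ∈ X := hy
  obtain ⟨T, hT, hj⟩ : ∃ T : Set V, (∀ w (hw : w ∈ X), w ∈ T → ⟨w, hw⟩ ∉ S) ∧ Joins G T x y := by
    rcases Nat.lt_succ_iff_lt_or_eq.1 hlt with h0 | h1
    · have : S = ∅ := Finset.card_eq_zero.1 (by omega)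
      exact ⟨Set.univ, by simp [this], hG x trivial y trivial⟩
    · obtain ⟨a, rfl⟩ := Finset.card_eq_one.1 h1
      refine ⟨{a.1}ᶜ, fun w hw hwa hwS => hwa ?_, hX.prop x hx' y hy' a.1 ?_ ?_⟩
      · rw [Finset.mem_singleton] at hwS
        rw [← hwS]; rfl
      · rintro rfl; simp at hxS
      · rintro rfl; simp at hyS
  have := (hj.inter_of_maximal hX hx' hy').induction
    (P := fun w => ∀ (hw : w ∈ X) (hwS : (⟨w, hw⟩ : ((⊤ : G.Subgraph).induce X).verts) ∉ S),
      ((((⊤ : G.Subgraph).induce X).coe).induce ((S : Set _)ᶜ)).Reachable ⟨⟨w, hw⟩, hwS⟩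
        ⟨⟨y, hy⟩, hyS⟩)
    (fun _ _ => SimpleGraph.Reachable.refl _) ?_
  · exact this hx' hxS
  intro s w hs hw hadj ih hsX hsS
  refine SimpleGraph.Reachable.trans (SimpleGraph.Adj.reachable ?_)
    (ih hw.2 (hT w hw.2 hw.1))
  exact ⟨hsX, hw.2, hadj⟩

theorem isBlock_induce [Finite V] (hG : Conn G Set.univ) (hX : Maximal (IsInsepSet G) X) :
    IsBlock G ((⊤ : G.Subgraph).induce X) := by
  refine ⟨connectivityAtLeast_of_maximal hG hX, fun B hB hle => ?_⟩
  have hv : B.verts ⊆ X := hX.le_of_ge hB.isInsepSet hle.1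
  exact ⟨hv, fun s w h => ⟨hv h.fst_mem, hv h.snd_mem, h.adj_sub⟩⟩

theorem IsBlock.eq_induce [Finite V] (hG : Conn G Set.univ) {B : G.Subgraph} (hB : IsBlock G B) :
    Maximal (IsInsepSet G) B.verts ∧ B = (⊤ : G.Subgraph).induce B.verts := by
  obtain ⟨X, hBX, hX⟩ := hB.prop.isInsepSet.exists_maximal
  have hle : B ≤ (⊤ : G.Subgraph).induce X :=
    ⟨hBX, fun s w h => ⟨hBX h.fst_mem, hBX h.snd_mem, h.adj_sub⟩⟩
  have heq : B = (⊤ : G.Subgraph).induce X :=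
    hle.antisymm (hB.le_of_ge (connectivityAtLeast_of_maximal hG hX) hle)
  have hv : B.verts = X := by rw [heq]; rfl
  rw [hv]
  exact ⟨hX, heq⟩

theorem IsBlock.ext [Finite V] (hG : Conn G Set.univ) {B C : G.Subgraph} (hB : IsBlock G B)
    (hC : IsBlock G C) (h : B.verts = C.verts) : B = C := by
  rw [(hB.eq_induce hG).2, (hC.eq_induce hG).2, h]

theorem exists_isBlock [Finite V] (hG : Conn G Set.univ) (hX : IsInsepSet G X) :
    ∃ B : {B : G.Subgraph // IsBlock G B}, X ⊆ B.1.verts := by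
  obtain ⟨Y, hXY, hY⟩ := hX.exists_maximal
  exact ⟨⟨_, isBlock_induce hG hY⟩, hXY⟩

/-- A vertex shared by two blocks separates their other vertices. -/
theorem not_joins_of_mem_two_blocks [Finite V] (hG : Conn G Set.univ)
    {B C : {B : G.Subgraph // IsBlock G B}} (hBC : B ≠ C) (huB : u ∈ B.1.verts)
    (huC : u ∈ C.1.verts) :
    IsCutVertex G u ∧ ∀ x ∈ B.1.verts, ∀ y ∈ C.1.verts, x ≠ u → y ≠ u → ¬ Joins G {u}ᶜ x y := by
  have hB := (B.2.eq_induce hG).1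
  have hC := (C.2.eq_induce hG).1
  obtain ⟨x₀, hx₀, y₀, hy₀, hn⟩ : ∃ x ∈ B.1.verts, ∃ y ∈ C.1.verts, ¬ Insep G x y := by
    by_contra! hcon
    refine hBC (Subtype.ext (B.2.ext hG C.2 (Set.Subset.antisymm ?_ ?_)))
    · exact fun z hz => mem_of_maximal_isInsepSet hC fun y hy => hcon z hz y hy
    · exact fun z hz => mem_of_maximal_isInsepSet hB fun x hx => (hcon x hx z hz).symm
  rw [Insep] at hn
  push Not at hn
  obtain ⟨a, hax, hay, hnj⟩ := hn
  obtain rfl : a = u := by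
    by_contra hau
    exact hnj ((hB.prop _ hx₀ _ huB a hax hau).trans (hC.prop _ huC _ hy₀ a hau hay))
  refine ⟨isCutVertex_iff.2 fun hc => hnj (hc _ hax.symm _ hay.symm), fun x hx y hy hxa hya hj => ?_⟩
  exact hnj ((hB.prop _ hx₀ _ hx a hax hxa.symm).trans
    (hj.trans (hC.prop _ hy _ hy₀ a hya.symm hay)))

/-- Of the three cut vertices of a fork one, `a m`, lies between the others on the path. Since `x m`
occupies one of the two components at `a m`, the other two cut vertices are joined in `G - a m`; but
a walk there never changes its side of `a m` on the path. -/
theorem not_hasFork_of_isPathGraph [Finite V] (hG : Conn G Set.univ)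
    (hcomp : ∀ v, numComponents G v ≤ 2) (hpath : IsPathGraph (blockDecomposition G)) :
    ¬ HasFork G := by
  rintro ⟨a, x, hinj, hxa, hsep⟩
  obtain ⟨k, ⟨e⟩⟩ := hpath
  let pos (w : {B : G.Subgraph // IsBlock G B} ⊕ {v : V // IsCutVertex G v}) : ℕ := (e w).val
  have hpos : ∀ w w', pos w = pos w' → w = w' := fun w w' h => e.injective (Fin.ext h)
  have hadj : ∀ w w', (blockDecomposition G).Adj w w' → pos w + 1 = pos w' ∨ pos w' + 1 = pos w :=
    fun w w' h => SimpleGraph.pathGraph_adj.1 (e.map_adj_iff.2 h)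
  have hcut : ∀ i, IsCutVertex G (a i) := fun i => by
    obtain ⟨j, hij⟩ := exists_ne i
    exact isCutVertex_iff.2 fun hc =>
      hsep i j hij.symm (hc _ (hxa i) _ fun he => hij (hinj he))
  let p (i : Fin 3) : ℕ := pos (.inr ⟨a i, hcut i⟩)
  have hp : ∀ i j, i ≠ j → p i ≠ p j := fun i j hij h =>
    hij (hinj (congrArg Subtype.val (Sum.inr_injective (hpos _ _ h))))
  have key : ∀ i m j, ¬ (p i < p m ∧ p m < p j) := by
    rintro i m j ⟨him, hmj⟩
    have hmi : m ≠ i := by rintro rfl; omega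
    have hmj' : m ≠ j := by rintro rfl; omega
    -- A block and its cut vertex occupy consecutive positions, neither of which is `p m`, so they
    -- are on the same side.
    have hblock : ∀ (B : {B : G.Subgraph // IsBlock G B}) u (hu : IsCutVertex G u),
        u ∈ B.1.verts → u ≠ a m → (pos (.inl B) < p m ↔ pos (.inr ⟨u, hu⟩) < p m) := by
      intro B u hu huB hne
      have h1 : pos (.inl B) ≠ p m := fun he => Sum.inl_ne_inr (hpos _ _ he)
      have h2 : pos (.inr ⟨u, hu⟩) ≠ p m := fun he =>
        hne (congrArg Subtype.val (Sum.inr_injective (hpos _ _ he)))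
      have h3 := hadj (.inl B) (.inr ⟨u, hu⟩) huB
      omega
    have hj : Joins G {a m}ᶜ (a j) (a i) := by
      rcases exists_joins_of_numComponents_le_two (hcomp (a m)) (hxa m)
        (fun he => hmi (hinj he).symm) (fun he => hmj' (hinj he).symm) with h | h | h
      · exact (hsep m i hmi h).elim
      · exact (hsep m j hmj' h).elim
      · exact h.symm
    have hside := hj.induction
      (P := fun u => ∀ B : {B : G.Subgraph // IsBlock G B}, u ∈ B.1.verts → pos (.inl B) < p m)
      (fun B hB => (hblock B _ (hcut i) hB hj.right_mem).2 him) ?_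
    · obtain ⟨B, hB⟩ := exists_isBlock hG (IsInsepSet.singleton (G := G) (a j))
      have hlt := (hblock B _ (hcut j) (hB rfl) hj.left_mem).1 (hside B (hB rfl))
      exact absurd hlt hmj.not_gt
    intro u w hu _ huw ih B hB
    obtain ⟨C, hC⟩ := exists_isBlock hG (IsInsepSet.pair huw)
    have hCm := ih C (hC (by simp))
    by_cases hBC : B = C
    · rwa [hBC]
    have huC : u ∈ C.1.verts := hC (by simp)
    have hucut := (not_joins_of_mem_two_blocks hG hBC hB huC).1
    exact (hblock B u hucut hB hu).2 ((hblock C u hucut huC hu).1 hCm)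
  have h01 := hp 0 1 (by decide)
  have h02 := hp 0 2 (by decide)
  have h12 := hp 1 2 (by decide)
  have k1 := key 0 1 2
  have k2 := key 0 2 1
  have k3 := key 1 0 2
  have k4 := key 1 2 0
  have k5 := key 2 0 1
  have k6 := key 2 1 0
  omega

/-- A finite connected graph with degrees at most two and a vertex of degree at most one is a
path. -/
theorem isPathGraph_of_degree_le_two {W : Type u} [Finite W] {H : SimpleGraph W}
    (hH : H.Preconnected)
    (hdeg : ∀ w a b c, H.Adj w a → H.Adj w b → H.Adj w c → a = b ∨ a = c ∨ b = c)
    {r : W} (hr : ∀ a b, H.Adj r a → H.Adj r b → a = b) : IsPathGraph H := by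
  classical
  have : Fintype W := Fintype.ofFinite W
  have : Nonempty W := ⟨r⟩
  have hconn : H.Connected := ⟨hH⟩
  have hpred : ∀ n w, H.dist r w = n + 1 → ∃ w', H.Adj w' w ∧ H.dist r w' = n := by
    intro n w hw
    obtain ⟨p, hp⟩ := hconn.exists_walk_length_eq_dist w r
    rw [SimpleGraph.dist_comm, hw] at hp
    cases p with
    | nil => simp at hp
    | cons h q =>
      rename_i s
      refine ⟨s, h.symm, ?_⟩
      have h1 : H.dist s r ≤ n := (SimpleGraph.dist_le q).trans (by simpa using hp.le)
      have h2 := hconn.dist_triangle (u := r) (v := s) (w := w)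
      rw [hw, SimpleGraph.dist_eq_one_iff_adj.2 h.symm] at h2
      rw [SimpleGraph.dist_comm] at h1
      omega
  -- Each distance from `r` occurs once: the unique vertex at the previous distance uses one of its
  -- two edges to go back, and `r` has only one edge. Distance is therefore the isomorphism.
  have hinj : ∀ n w w', H.dist r w = n → H.dist r w' = n → w = w' := by
    intro n
    induction n using Nat.strong_induction_on with
    | _ n ih =>
    intro w w' hw hw'
    rcases n with _ | n
    · rw [hconn.dist_eq_zero_iff] at hw hw'
      rw [← hw, ← hw']
    obtain ⟨s, hs, hsn⟩ := hpred n w hw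
    obtain ⟨s', hs', hsn'⟩ := hpred n w' hw'
    obtain rfl := ih n (Nat.lt_succ_self n) s s' hsn hsn'
    rcases n with _ | n
    · obtain rfl := hconn.dist_eq_zero_iff.1 hsn
      exact hr _ _ hs hs'
    · obtain ⟨q, hq, hqn⟩ := hpred n s hsn
      rcases hdeg s q w w' hq.symm hs hs' with rfl | rfl | h
      · omega
      · omega
      · exact h
  have hlt : ∀ w, H.dist r w < Fintype.card W := fun w => by
    obtain ⟨p, hp, hp'⟩ := hconn.exists_path_of_dist r w
    rw [← hp']
    exact hp.length_lt
  let f (w : W) : Fin (Fintype.card W) := ⟨H.dist r w, hlt w⟩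
  have hf : Function.Bijective f := (Fintype.bijective_iff_injective_and_card f).2
    ⟨fun w w' h => hinj _ w w' (congrArg Fin.val h) rfl, by simp⟩
  refine ⟨Fintype.card W, ⟨⟨Equiv.ofBijective f hf, fun {w w'} => ?_⟩⟩⟩
  rw [SimpleGraph.pathGraph_adj]
  change H.dist r w + 1 = H.dist r w' ∨ H.dist r w' + 1 = H.dist r w ↔ H.Adj w w'
  have hback : ∀ w w', H.dist r w + 1 = H.dist r w' → H.Adj w w' := fun w w' h => by
    obtain ⟨s, hs, hsn⟩ := hpred _ w' h.symm
    rwa [← hinj _ s w hsn rfl]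
  constructor
  · rintro (h | h)
    · exact hback _ _ h
    · exact (hback _ _ h).symm
  · intro h
    have h1 := hconn.dist_triangle (u := r) (v := w) (w := w')
    have h2 := hconn.dist_triangle (u := r) (v := w') (w := w)
    rw [SimpleGraph.dist_eq_one_iff_adj.2 h] at h1
    rw [SimpleGraph.dist_eq_one_iff_adj.2 h.symm] at h2
    have h3 : H.dist r w ≠ H.dist r w' := fun he => h.ne (hinj _ w w' rfl he.symm)
    omega

/-- A walk in `G` is followed edge by edge: each edge lies in a block, and distinct blocks with a
common vertex are both adjacent to it in the decomposition, because it is a cut vertex. -/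
theorem blockDecomposition_preconnected [Finite V] [Nonempty V] (hG : Conn G Set.univ) :
    (blockDecomposition G).Preconnected := by
  have hshare : ∀ u (B C : {B : G.Subgraph // IsBlock G B}), u ∈ B.1.verts → u ∈ C.1.verts →
      (blockDecomposition G).Reachable (.inl B) (.inl C) := by
    intro u B C hB hC
    by_cases hBC : B = C
    · rw [hBC]
    have hcut := (not_joins_of_mem_two_blocks hG hBC hB hC).1
    have h1 : (blockDecomposition G).Adj (.inl B) (.inr ⟨u, hcut⟩) := hB
    have h2 : (blockDecomposition G).Adj (.inr ⟨u, hcut⟩) (.inl C) := hC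
    exact h1.reachable.trans h2.reachable
  have hblocks : ∀ B C : {B : G.Subgraph // IsBlock G B},
      (blockDecomposition G).Reachable (.inl B) (.inl C) := by
    have hne : ∀ B : {B : G.Subgraph // IsBlock G B}, B.1.verts.Nonempty := by
      intro B
      by_contra hcon
      rw [Set.not_nonempty_iff_eq_empty] at hcon
      obtain ⟨v⟩ := ‹Nonempty V›
      have := mem_of_maximal_isInsepSet (z := v) (B.2.eq_induce hG).1 (by simp [hcon])
      simp [hcon] at this
    intro B C
    obtain ⟨x, hx⟩ := hne B
    obtain ⟨y, hy⟩ := hne C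
    refine (hG x trivial y trivial).induction
      (P := fun u => ∀ B : {B : G.Subgraph // IsBlock G B}, u ∈ B.1.verts →
        (blockDecomposition G).Reachable (.inl B) (.inl C))
      (fun B hB => hshare y B C hB hy) ?_ B hx
    intro u w _ _ huw ih B hB
    obtain ⟨A, hA⟩ := exists_isBlock hG (IsInsepSet.pair huw)
    exact (hshare u B A hB (hA (by simp))).trans (ih A (hA (by simp)))
  have hcutv : ∀ v : {v : V // IsCutVertex G v}, ∃ B : {B : G.Subgraph // IsBlock G B},
      (blockDecomposition G).Reachable (.inr v) (.inl B) := by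
    intro v
    obtain ⟨B, hB⟩ := exists_isBlock hG (IsInsepSet.singleton (G := G) v.1)
    have h : (blockDecomposition G).Adj (.inr v) (.inl B) := hB rfl
    exact ⟨B, h.reachable⟩
  rintro (B | v) (C | w)
  · exact hblocks B C
  · obtain ⟨C, hC⟩ := hcutv w
    exact (hblocks B C).trans hC.symm
  · obtain ⟨B, hB⟩ := hcutv v
    exact hB.trans (hblocks B C)
  · obtain ⟨B, hB⟩ := hcutv v
    obtain ⟨C, hC⟩ := hcutv w
    exact hB.trans ((hblocks B C).trans hC.symm)

/-- Three cut vertices in one block form a fork. -/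
theorem IsInsepSet.hasFork (hX : IsInsepSet G X) (a : Fin 3 → V) (ha : Function.Injective a)
    (haX : ∀ i, a i ∈ X) (hcut : ∀ i, IsCutVertex G (a i)) : HasFork G := by
  have hex : ∀ i, ∃ x, x ≠ a i ∧ ∀ j, i ≠ j → ¬ Joins G {a i}ᶜ x (a j) := by
    intro i
    obtain ⟨j, hji⟩ := exists_ne i
    obtain ⟨x, hx, hxj⟩ : ∃ x ∈ ({a i}ᶜ : Set V), ¬ Joins G {a i}ᶜ x (a j) := by
      by_contra! hcon
      exact isCutVertex_iff.1 (hcut i) (Conn.of_center hcon)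
    refine ⟨x, hx, fun l hl hj => hxj (hj.trans ?_)⟩
    exact hX _ (haX l) _ (haX j) _ (fun he => hl (ha he)) (fun he => hji (ha he).symm)
  choose x hx hsep using hex
  exact ⟨a, x, ha, hx, hsep⟩

/-- A block with three cut vertices gives a fork, and a cut vertex in three blocks leaves three
components, so all degrees are at most two. A component free of cut vertices yields an end block
`L`. -/
theorem isPathGraph_of_not_hasFork [Finite V] (hG : Conn G Set.univ)
    (hcomp : ∀ v, numComponents G v ≤ 2) (hv : IsCutVertex G v) (hfork : ¬ HasFork G) :
    IsPathGraph (blockDecomposition G) := by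
  have : Nonempty V := ⟨v⟩
  obtain ⟨y, hy⟩ : ∃ y, y ∈ ({v}ᶜ : Set V) := by
    by_contra! hcon
    exact isCutVertex_iff.1 hv fun x hx => (hcon x hx).elim
  obtain ⟨w, hw, -, z, hz, -, hzN⟩ := exists_component_avoiding (N := {v | IsCutVertex G v}) hG
    (Set.subset_univ _) (fun v hv => by rw [← Set.compl_eq_univ_sdiff]; exact isCutVertex_iff.1 hv)
    hv (y := y) ⟨trivial, hy⟩
  rw [← Set.compl_eq_univ_sdiff] at hzN
  obtain ⟨L, hL⟩ := exists_isBlock hG (IsInsepSet.singleton (G := G) z)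
  have hL' : ∀ n ∈ L.1.verts, IsCutVertex G n → n = w := by
    intro n hn hcut
    by_contra hnw
    exact hzN n hcut ((L.2.eq_induce hG).1.prop z (hL rfl) n hn w (Ne.symm hz.2) (Ne.symm hnw))
  refine isPathGraph_of_degree_le_two (blockDecomposition_preconnected hG) ?_ (r := .inl L) ?_
  · rintro (B | c) (B₁ | c₁) (B₂ | c₂) (B₃ | c₃) h₁ h₂ h₃ <;>
      first | exact h₁.elim | exact h₂.elim | exact h₃.elim | skip
    · by_contra! hne
      obtain ⟨h12, h13, h23⟩ := hne
      have hne' : ∀ {c c' : {v : V // IsCutVertex G v}},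
          (Sum.inr c : {B : G.Subgraph // IsBlock G B} ⊕ _) ≠ .inr c' → c.1 ≠ c'.1 :=
        fun h he => h (congrArg _ (Subtype.ext he))
      refine hfork ((B.2.eq_induce hG).1.prop.hasFork ![c₁, c₂, c₃]
        (injective_vecCons_three (hne' h12) (hne' h13) (hne' h23)) ?_ ?_)
      · intro i
        fin_cases i
        exacts [h₁, h₂, h₃]
      · intro i
        fin_cases i
        exacts [c₁.2, c₂.2, c₃.2]
    -- A block consisting of `c` alone would not be maximal, since a neighbour of `c` is inseparable
    -- from it.
    · have hother : ∀ B : {B : G.Subgraph // IsBlock G B}, c.1 ∈ B.1.verts →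
          ∃ x ∈ B.1.verts, x ≠ c.1 := by
        intro B hB
        by_contra! hcon
        obtain ⟨s, hs, t, ht, hadj⟩ := exists_adj_of_conn_univ (S := {c.1}) hG ⟨c.1, rfl⟩ (by
          by_contra hcon'
          rw [Set.not_nonempty_iff_eq_empty] at hcon'
          exact isCutVertex_iff.1 c.2 (hcon' ▸ conn_empty))
        obtain rfl : s = c.1 := hs
        refine ht (hcon t (mem_of_maximal_isInsepSet (B.2.eq_induce hG).1 fun x hx => ?_))
        rw [hcon x hx]
        exact .of_adj hadj.symm
      obtain ⟨x₁, hx₁, hx₁c⟩ := hother B₁ h₁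
      obtain ⟨x₂, hx₂, hx₂c⟩ := hother B₂ h₂
      obtain ⟨x₃, hx₃, hx₃c⟩ := hother B₃ h₃
      by_contra! hne
      obtain ⟨h12, h13, h23⟩ := hne
      rcases exists_joins_of_numComponents_le_two (hcomp c.1) hx₁c hx₂c hx₃c with hj | hj | hj
      · exact (not_joins_of_mem_two_blocks hG (fun h => h12 (congrArg _ h)) h₁ h₂).2
          _ hx₁ _ hx₂ hx₁c hx₂c hj
      · exact (not_joins_of_mem_two_blocks hG (fun h => h13 (congrArg _ h)) h₁ h₃).2
          _ hx₁ _ hx₃ hx₁c hx₃c hj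
      · exact (not_joins_of_mem_two_blocks hG (fun h => h23 (congrArg _ h)) h₂ h₃).2
          _ hx₂ _ hx₃ hx₂c hx₃c hj
  · rintro (B₁ | c₁) (B₂ | c₂) h₁ h₂
    · exact h₁.elim
    · exact h₁.elim
    · exact h₂.elim
    · exact congrArg _ (Subtype.ext ((hL' _ h₁ c₁.2).trans (hL' _ h₂ c₂.2).symm))

end Blocks

end PriceOfConnectivity

theorem mainTheorem2 {V : Type*} [Fintype V] (G : SimpleGraph V)
    (hG : PriceOfConnectivity.HasConnectivity G 1) :
    (PriceOfConnectivity.maxComponents G = 2 →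
      (PriceOfConnectivity.IsPathGraph (PriceOfConnectivity.blockDecomposition G) →
        PriceOfConnectivity.egalPoC G 2 = 2) ∧
      (¬ PriceOfConnectivity.IsPathGraph (PriceOfConnectivity.blockDecomposition G) →
        PriceOfConnectivity.egalPoC G 2 = 3)) ∧
    (3 ≤ PriceOfConnectivity.maxComponents G →
      PriceOfConnectivity.egalPoC G 2 = (PriceOfConnectivity.maxComponents G : ENNReal)) := by
  open PriceOfConnectivity in
  obtain ⟨⟨S, hS1, hS⟩, hmin⟩ := hG
  obtain ⟨a, rfl⟩ := Finset.card_eq_one.1 hS1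
  have hcut : IsCutVertex G a := by rwa [IsCutVertex, ← Finset.coe_singleton]
  have hconn : Conn G Set.univ := by
    rw [conn_iff]
    by_contra hn
    have : 1 ≤ 0 := hmin ⟨∅, rfl, by rwa [Finset.coe_empty, Set.compl_empty]⟩
    omega
  have hle : ∀ v, numComponents G v ≤ maxComponents G := fun v =>
    Finset.le_sup (f := fun v => numComponents G v) (Finset.mem_univ v)
  obtain ⟨v, -, hv⟩ := Finset.exists_mem_eq_sup Finset.univ ⟨a, Finset.mem_univ a⟩
    fun v => numComponents G v
  have hv : maxComponents G = numComponents G v := hv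
  have hlower : 0 < maxComponents G → (maxComponents G : ENNReal) ≤ egalPoC G 2 := fun h => by
    rw [hv] at h ⊢
    exact numComponents_le_egalPoC h
  refine ⟨fun h2 => ⟨fun hpath => ?_, fun hpath => ?_⟩, fun h3 => ?_⟩
  · rw [h2] at hle hlower
    refine le_antisymm (egalPoC_le le_rfl fun f g t h => ?_) (hlower (by norm_num))
    exact not_hasFork_of_isPathGraph hconn hle hpath (h.hasFork hconn hle (isCutVertex_iff.1 hcut))
  · rw [h2] at hle
    refine le_antisymm (egalPoC_le (D := 3) (by norm_num) fun f g t h => ?_) ?_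
    · exact h.false_of_three_le hconn le_rfl fun v => (hle v).trans (by norm_num)
    · by_contra hlt
      exact hpath (isPathGraph_of_not_hasFork hconn hle hcut
        fun hf => hlt (hf.three_le_egalPoC hconn))
  · exact le_antisymm (egalPoC_le (by omega) fun f g t h => h.false_of_three_le hconn h3 hle)
      (hlower (by omega))
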